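/- Consider the two-dimensional directed regular lattice with vertex set $\mathbb{N}^2=\{0,1,2,\dots\}^2$ and an edge from $v$ to $v'$ exactly when $v'=v+(1,0)$ or $v'=v+(0,1)$. Let the rewards $r(v)$, $v\in\mathbb{N}^2$, be independent and identically distributed real random variables whose common law is either exponential (with some rate $\lambda>0$) or geometric on $\{1,2,\dots\}$ (that is, $\mathbb{P}(r(v)=k)=p(1-p)^{k-1}$ for $k\ge 1$, with some $p\in(0,1]$). Let $\mu$ be the mean and $\sigma^2$ the variance of this law, with $\sigma\ge 0$. For $n\ge 1$ let $$T^*_2(n)=\max_{\pi}\sum_{v\in\pi} r(v),$$ where the maximum is over all directed lattice paths $\pi$ that start at the origin and cross exactly $n$ vertices (the origin included), and let $R^*_2(n)=T^*_2(n)/n$. Then every $R^*_2(n)$ is integrable, and the expected maximum mean reward $\mathbf{R}^*_2:=\lim_{n\to\infty}\mathbb{E}[R^*_2(n)]$ exists and equals $$\mathbf{R}^*_2=\mu+\sigma .$$ -/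

import Mathlib

open MeasureTheory ProbabilityTheory Filter Topology

/-- The directed edges of the `d`-dimensional regular lattice with vertex set `ℕ^d`: an edge
raises exactly one coordinate by one. -/
def LatticeEdge {d : ℕ} (v v' : Fin d → ℕ) : Prop :=
  ∃ k : Fin d, v' = v + Pi.single k 1

/-- The set of all directed lattice paths (sequences of vertices, consecutive ones joined by an
edge) that start at `v₀` and cross exactly `n` vertices, the vertex `v₀` included. -/
def latticePaths {d : ℕ} (v₀ : Fin d → ℕ) (n : ℕ) : Set (List (Fin d → ℕ)) :=
  {π | π.head? = some v₀ ∧ π.length = n ∧ π.IsChain LatticeEdge}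

/-- The maximum total reward over the paths that start at `v₀` and cross exactly `n` vertices.
For `1 ≤ d` and `1 ≤ n` the supremum is over a finite nonempty set, hence a maximum
(see `isGreatest_maxTotalReward`); for `n = 0` the value is `0`. -/
noncomputable def maxTotalReward {d : ℕ} (r : (Fin d → ℕ) → ℝ) (v₀ : Fin d → ℕ) (n : ℕ) : ℝ :=
  sSup ((fun π : List (Fin d → ℕ) => (π.map r).sum) '' latticePaths v₀ n)

/-- The maximum mean reward: the maximum total reward over the paths that start at the origin and
cross exactly `n` vertices, divided by `n`. -/
noncomputable def maxMeanReward {d : ℕ} (r : (Fin d → ℕ) → ℝ) (n : ℕ) : ℝ :=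
  maxTotalReward r 0 n / n

/-- `ν` is an exponential distribution, with some rate `a > 0`. -/
def IsExponentialLaw (ν : Measure ℝ) : Prop :=
  ∃ a : ℝ, 0 < a ∧ ν = expMeasure a

/-- `ν` is a geometric distribution on `{1, 2, 3, …}`, with some success probability
`0 < p ≤ 1`, that is, it gives mass `p * (1 - p) ^ (k - 1)` to each integer `k ≥ 1`. (Mathlib's
`geometricMeasure p` gives mass `(1 - p) ^ k * p` to `k ≥ 0`.) -/
def IsGeometricLaw (ν : Measure ℝ) : Prop :=
  ∃ p : unitInterval, p ≠ 0 ∧ ν = (geometricMeasure p).map (fun k : ℕ => (k : ℝ) + 1)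

theorem latticePaths_finite {d : ℕ} (v₀ : Fin d → ℕ) (n : ℕ) : (latticePaths v₀ n).Finite := by
  induction n generalizing v₀ with
  | zero =>
    refine Set.Finite.subset (Set.finite_singleton []) ?_
    rintro π ⟨-, h, -⟩
    simpa using h
  | succ n ih =>
    refine Set.Finite.subset ((Set.finite_singleton [v₀]).union
      (Set.finite_iUnion fun k : Fin d => (ih (v₀ + Pi.single k 1)).image (List.cons v₀))) ?_
    rintro π ⟨h₁, h₂, h₃⟩
    match π, h₁, h₂, h₃ with
    | [a], h₁, _, _ =>
      left
      simpa using h₁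
    | a :: b :: l, h₁, h₂, h₃ =>
      right
      obtain rfl : a = v₀ := by simpa using h₁
      obtain ⟨⟨k, hk⟩, h₄⟩ := List.isChain_cons_cons.1 h₃
      refine Set.mem_iUnion.2 ⟨k, b :: l, ⟨?_, ?_, h₄⟩, rfl⟩
      · simp [hk]
      · simpa using h₂

theorem latticePaths_nonempty {d : ℕ} (hd : 1 ≤ d) (v₀ : Fin d → ℕ) (n : ℕ) :
    (latticePaths v₀ (n + 1)).Nonempty := by
  induction n generalizing v₀ with
  | zero => exact ⟨[v₀], by simp [latticePaths]⟩
  | succ n ih =>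
    obtain ⟨π, h₁, h₂, h₃⟩ := ih (v₀ + Pi.single ⟨0, hd⟩ 1)
    match π, h₁, h₂, h₃ with
    | b :: l, h₁, h₂, h₃ =>
      refine ⟨v₀ :: b :: l, rfl, ?_, List.isChain_cons_cons.2 ⟨⟨⟨0, hd⟩, ?_⟩, h₃⟩⟩
      · simpa using h₂
      · simpa using h₁

theorem isGreatest_maxTotalReward {d : ℕ} (hd : 1 ≤ d) (r : (Fin d → ℕ) → ℝ) (v₀ : Fin d → ℕ)
    {n : ℕ} (hn : 1 ≤ n) :
    IsGreatest ((fun π : List (Fin d → ℕ) => (π.map r).sum) '' latticePaths v₀ n)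
      (maxTotalReward r v₀ n) := by
  obtain ⟨m, rfl⟩ := Nat.exists_eq_add_of_le' hn
  have hfin := (latticePaths_finite v₀ (m + 1)).image
    (fun π : List (Fin d → ℕ) => (π.map r).sum)
  have hne := (latticePaths_nonempty hd v₀ m).image
    (fun π : List (Fin d → ℕ) => (π.map r).sum)
  exact ⟨hne.csSup_mem hfin, fun x hx => le_csSup hfin.bddAbove hx⟩

/-! # The maximum mean reward in the two-dimensional directed lattice

Values on an antidiagonal of the lattice are evolved down to the origin. If the terminal values form
a random walk whose increments are differences of independent variables with a suitable memoryless
law, then Burke's property shows that the walk is stationary, so that the expected growth is exact.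
The maximum of the walk is negligible, and the terminal values can be replaced by zero. -/

/-! Totals are computed backwards: values on an antidiagonal determine those on the previous one
through `growthStep`, and zero values on the `n`-th antidiagonal produce `maxTotalReward` at the
origin. Let `κ` be the law of the same family with `ν` as the law of the minimum of two independent
`κ`-variables: rate `a / 2` in the exponential case, failure probability `√(1 - p)` in the geometric
case. Both times `κ` has mean `μ + σ`.

Suppose that the terminal values form a walk with increments `I - J`, all `I` and `J` being
independent with law `κ`. By Burke's property (`measurePreserving_cornerStep`) the next antidiagonal
carries a walk of the same kind, whose value at site `0` has moved by a `κ`-variable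
(`growthStep_pairWalk`). So the expected value at the origin is exactly `n` times the mean of `κ`
(`integral_cornerGrowth_pairWalk`).

Growth is nonexpansive in the sup norm, so replacing the walk by zero costs at most its maximum
modulus. The expectation of that is at most `t⁻¹ * (log (2 * (n + 1)) + n * ψ t + 1)`, where `ψ` is
the cumulant generating function of `I - J`. As `I - J` is centred, `ψ t = o(t)`; dividing by `n`, a
small fixed `t` and then a large `n` make the error negligible. -/

/-- The one-step update of a pair of increments `(I, J)` at a corner with reward `r`. -/
def cornerStep (q : (ℝ × ℝ) × ℝ) : ℝ × ℝ :=
  (max (q.1.1 - q.1.2) 0 + q.2, max (q.1.2 - q.1.1) 0 + q.2)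

theorem measurable_cornerStep : Measurable cornerStep := by
  unfold cornerStep
  fun_prop

/-! ### Memoryless laws and Burke's property -/

/-- A law is memoryless if, conditioned to exceed any threshold, it is a translate of itself. -/
def IsMemoryless (κ : Measure ℝ) : Prop :=
  ∀ t : ℝ, ∃ s : ℝ, (κ.restrict (Set.Ici t)).map (fun x => x - s) = κ (Set.Ici t) • κ

/-- The event `min ≥ t` says that both variables are at least `t`. Restricting to it translates both
by the same `s`, up to mass, so their difference keeps its law: difference and minimum are
independent. The argument covers continuous and lattice laws alike. -/
theorem map_sub_min_eq_prod {κ ν : Measure ℝ} [IsProbabilityMeasure κ] [IsProbabilityMeasure ν]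
    (hκ : IsMemoryless κ) (hν : ∀ t : ℝ, ν (Set.Ici t) = κ (Set.Ici t) ^ 2) :
    (κ.prod κ).map (fun p : ℝ × ℝ => (p.1 - p.2, min p.1 p.2)) =
      ((κ.prod κ).map fun p : ℝ × ℝ => p.1 - p.2).prod ν := by
  have hmeas : Measurable fun p : ℝ × ℝ => (p.1 - p.2, min p.1 p.2) := by fun_prop
  have hsub : Measurable fun p : ℝ × ℝ => p.1 - p.2 := by fun_prop
  have hmin : Measurable fun p : ℝ × ℝ => min p.1 p.2 := by fun_prop
  refine (Measure.prod_eq fun S T hS hT => ?_).symm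
  have key : ((κ.prod κ).restrict ((fun p : ℝ × ℝ => p.1 - p.2) ⁻¹' S)).map
      (fun p : ℝ × ℝ => min p.1 p.2) =
      ((κ.prod κ).map (fun p : ℝ × ℝ => p.1 - p.2) S) • ν := by
    refine Measure.ext_of_Ici _ _ fun t => ?_
    obtain ⟨s, hs⟩ := hκ t
    have hms : Measurable fun x : ℝ => x - s := by fun_prop
    have hpre : (fun p : ℝ × ℝ => min p.1 p.2) ⁻¹' Set.Ici t = Set.Ici t ×ˢ Set.Ici t := by
      ext p
      simp [Prod.le_def]
    have hpre' : (Prod.map (fun x : ℝ => x - s) fun x : ℝ => x - s) ⁻¹'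
        ((fun p : ℝ × ℝ => p.1 - p.2) ⁻¹' S) = (fun p : ℝ × ℝ => p.1 - p.2) ⁻¹' S := by
      ext p
      simp
    have hprod : (((κ.restrict (Set.Ici t)).prod (κ.restrict (Set.Ici t))).map
        (Prod.map (fun x : ℝ => x - s) fun x : ℝ => x - s)) =
        (κ (Set.Ici t) • κ).prod (κ (Set.Ici t) • κ) := by
      rw [← Measure.map_prod_map _ _ hms hms, hs]
    have := congrArg (fun m : Measure (ℝ × ℝ) => m ((fun p : ℝ × ℝ => p.1 - p.2) ⁻¹' S)) hprod
    simp only [Measure.map_apply (hms.prodMap hms) (hsub hS), hpre', Measure.prod_restrict] at this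
    rw [Measure.map_apply hmin measurableSet_Ici, hpre, Measure.restrict_apply
      (measurableSet_Ici.prod measurableSet_Ici), Set.inter_comm,
      ← Measure.restrict_apply (hsub hS), this, Measure.smul_apply, hν t,
      Measure.map_apply hsub hS, Measure.prod_smul_left, Measure.prod_smul_right]
    simp only [Measure.smul_apply, smul_eq_mul]
    ring
  have := congrArg (fun m : Measure ℝ => m T) key
  simp only [Measure.map_apply hmin hT, Measure.restrict_apply (hmin hT), Measure.smul_apply,
    smul_eq_mul] at this
  rw [← this, Measure.map_apply hmeas (hS.prod hT)]
  congr 1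
  ext p
  simp [and_comm]

/-- Burke's property: independent increments with a memoryless law `κ` remain independent with the
same law after a corner step, if the reward has the law of the minimum of two of them. -/
theorem measurePreserving_cornerStep {κ ν : Measure ℝ} [IsProbabilityMeasure κ]
    [IsProbabilityMeasure ν] (hκ : IsMemoryless κ)
    (hν : ∀ t : ℝ, ν (Set.Ici t) = κ (Set.Ici t) ^ 2) :
    MeasurePreserving cornerStep ((κ.prod κ).prod ν) (κ.prod κ) := by
  refine ⟨measurable_cornerStep, ?_⟩
  have hsub : Measurable fun p : ℝ × ℝ => p.1 - p.2 := by fun_prop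
  have hg : Measurable fun p : ℝ × ℝ => (max p.1 0 + p.2, max (-p.1) 0 + p.2) := by fun_prop
  have hmeas : Measurable fun p : ℝ × ℝ => (p.1 - p.2, min p.1 p.2) := by fun_prop
  -- The step sees `(I, J)` only through `I - J`. With `min I J` in place of the reward it would
  -- return `(I, J)` itself, and `(I - J, min I J)` has the same law as `I - J` with an independent
  -- reward.
  have h₁ : cornerStep = (fun p : ℝ × ℝ => (max p.1 0 + p.2, max (-p.1) 0 + p.2)) ∘
      Prod.map (fun p : ℝ × ℝ => p.1 - p.2) id := by
    ext q <;> simp [cornerStep]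
  have h₂ : (fun p : ℝ × ℝ => (max p.1 0 + p.2, max (-p.1) 0 + p.2)) ∘
      (fun p : ℝ × ℝ => (p.1 - p.2, min p.1 p.2)) = id := by
    ext p <;> rcases le_total p.1 p.2 with h | h <;> simp [h]
  rw [h₁, ← Measure.map_map hg (hsub.prodMap measurable_id),
    ← Measure.map_prod_map _ _ hsub measurable_id, Measure.map_id, ← map_sub_min_eq_prod hκ hν,
    Measure.map_map hg hmeas, h₂, Measure.map_id]

/-! ### Recursion for the maximum total reward -/

theorem maxTotalReward_zero {d : ℕ} (f : (Fin d → ℕ) → ℝ) (v : Fin d → ℕ) :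
    maxTotalReward f v 0 = 0 := by
  have : latticePaths v 0 = ∅ := by
    refine Set.eq_empty_of_forall_notMem ?_
    rintro π ⟨h₁, h₂, -⟩
    simp_all
  simp [maxTotalReward, this]

theorem cons_mem_latticePaths {d : ℕ} (v : Fin d → ℕ) (k : Fin d) {n : ℕ}
    {π : List (Fin d → ℕ)} (h : π ∈ latticePaths (v + Pi.single k 1) n) :
    v :: π ∈ latticePaths v (n + 1) := by
  obtain ⟨h₁, h₂, h₃⟩ := h
  match π, h₁ with
  | a :: l, h₁ =>
    obtain rfl : a = v + Pi.single k 1 := by simpa using h₁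
    exact ⟨rfl, by simpa using h₂, List.isChain_cons_cons.2 ⟨⟨k, rfl⟩, h₃⟩⟩

theorem exists_of_mem_latticePaths {d : ℕ} {v : Fin d → ℕ} {n : ℕ}
    {π : List (Fin d → ℕ)} (h : π ∈ latticePaths v (n + 2)) :
    ∃ k, ∃ π' ∈ latticePaths (v + Pi.single k 1) (n + 1), π = v :: π' := by
  obtain ⟨h₁, h₂, h₃⟩ := h
  match π, h₁, h₂, h₃ with
  | a :: b :: l, h₁, h₂, h₃ =>
    obtain rfl : a = v := by simpa using h₁
    obtain ⟨⟨k, hk⟩, h₄⟩ := List.isChain_cons_cons.1 h₃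
    exact ⟨k, b :: l, ⟨by simp [hk], by simpa using h₂, h₄⟩, rfl⟩

/-- Paths are split by their second vertex. The case `n = 0` fits because the supremum over no paths
is `0`. The vertical neighbour comes first to match `growthStep`, since antidiagonals are indexed by
the first coordinate. -/
theorem maxTotalReward_succ (f : (Fin 2 → ℕ) → ℝ) (v : Fin 2 → ℕ) (n : ℕ) :
    maxTotalReward f v (n + 1) = max (maxTotalReward f (v + Pi.single 1 1) n)
      (maxTotalReward f (v + Pi.single 0 1) n) + f v := by
  rcases n with - | n
  · have : latticePaths v 1 = {[v]} := by
      ext π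
      constructor
      · rintro ⟨h₁, h₂, -⟩
        obtain ⟨a, rfl⟩ := List.length_eq_one_iff.1 h₂
        simpa using h₁
      · rintro rfl
        simp [latticePaths]
    rw [maxTotalReward_zero, maxTotalReward_zero, maxTotalReward, this]
    simp
  · have hg := fun w : Fin 2 → ℕ => isGreatest_maxTotalReward one_le_two f w (Nat.le_add_left 1 n)
    have hG := isGreatest_maxTotalReward one_le_two f v (Nat.le_add_left 1 (n + 1))
    apply le_antisymm
    · obtain ⟨π, hπ, hsum⟩ := hG.1
      obtain ⟨k, π', hπ', rfl⟩ := exists_of_mem_latticePaths hπ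
      have hle := (hg _).2 ⟨π', hπ', rfl⟩
      rw [← hsum]
      simp only [List.map_cons, List.sum_cons] at hle ⊢
      obtain rfl | rfl : k = 0 ∨ k = 1 := by omega
      · linarith [le_max_right (maxTotalReward f (v + Pi.single 1 1) (n + 1))
          (maxTotalReward f (v + Pi.single 0 1) (n + 1))]
      · linarith [le_max_left (maxTotalReward f (v + Pi.single 1 1) (n + 1))
          (maxTotalReward f (v + Pi.single 0 1) (n + 1))]
    · have hk : ∀ k : Fin 2, maxTotalReward f (v + Pi.single k 1) (n + 1) + f v ≤
          maxTotalReward f v (n + 1 + 1) := by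
        intro k
        obtain ⟨π, hπ, hsum⟩ := (hg (v + Pi.single k 1)).1
        have hle := hG.2 ⟨v :: π, cons_mem_latticePaths v k hπ, rfl⟩
        simp only [List.map_cons, List.sum_cons] at hle hsum
        linarith
      rcases max_choice (maxTotalReward f (v + Pi.single 1 1) (n + 1))
        (maxTotalReward f (v + Pi.single 0 1) (n + 1)) with h | h <;> rw [h]
      exacts [hk 1, hk 0]

/-! ### Growth from terminal values on an antidiagonal -/

/-- One step of the corner growth dynamics: from values on the `n + 1`-st antidiagonal of `ℕ²` to
values on the `n`-th one, whose points have the rewards `w`. -/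
def growthStep {n : ℕ} (h : Fin (n + 2) → ℝ) (w : Fin (n + 1) → ℝ) : Fin (n + 1) → ℝ :=
  fun x => max (h x.castSucc) (h x.succ) + w x

/-- The rewards on the `n`-th antidiagonal. -/
def antidiagonalRow (f : (Fin 2 → ℕ) → ℝ) (n : ℕ) : Fin (n + 1) → ℝ :=
  fun x => f ![(x : ℕ), n - x]

/-- The maximum reward of a path from the origin to the `n`-th antidiagonal, where the last vertex
is rewarded with the terminal value `h`. -/
def cornerGrowth : (n : ℕ) → (Fin (n + 1) → ℝ) → ((Fin 2 → ℕ) → ℝ) → ℝ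
  | 0, h, _ => h 0
  | n + 1, h, f => cornerGrowth n (growthStep h (antidiagonalRow f n)) f

/-- The induction trades one antidiagonal of growth for one more vertex in the terminal optimum. At
`m = 0` the `n` vertices fill antidiagonals `0` to `n - 1`, and the `n`-th carries zeros. -/
theorem cornerGrowth_maxTotalReward (f : (Fin 2 → ℕ) → ℝ) (n m : ℕ) :
    cornerGrowth n (fun x => maxTotalReward f ![(x : ℕ), n - x] m) f =
      maxTotalReward f 0 (n + m) := by
  induction n generalizing m with
  | zero =>
    have : ![0, 0] = (0 : Fin 2 → ℕ) := by
      ext i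
      fin_cases i <;> rfl
    simp [cornerGrowth, this]
  | succ n ih =>
    rw [cornerGrowth, show n + 1 + m = n + (m + 1) by ring, ← ih (m + 1)]
    congr 1
    ext x
    have hx : (x : ℕ) ≤ n := Nat.lt_succ_iff.1 x.2
    rw [growthStep, maxTotalReward_succ, antidiagonalRow]
    congr 3
    · ext i
      fin_cases i
      · simp
      · simp
        omega
    · ext i
      fin_cases i <;> simp

theorem cornerGrowth_zero (f : (Fin 2 → ℕ) → ℝ) (n : ℕ) :
    cornerGrowth n 0 f = maxTotalReward f 0 n := by
  rw [← add_zero n, ← cornerGrowth_maxTotalReward]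
  simp only [maxTotalReward_zero]
  rfl

theorem cornerGrowth_congr {n : ℕ} (h : Fin (n + 1) → ℝ) {f g : (Fin 2 → ℕ) → ℝ}
    (hfg : ∀ v : Fin 2 → ℕ, v 0 + v 1 < n → f v = g v) :
    cornerGrowth n h f = cornerGrowth n h g := by
  induction n with
  | zero => rfl
  | succ n ih =>
    rw [cornerGrowth, cornerGrowth, ih _ fun v hv => hfg v (by omega)]
    congr 2
    ext x
    refine hfg _ ?_
    have := x.2
    simp
    omega

theorem cornerGrowth_le_add {n : ℕ} {h h' : Fin (n + 1) → ℝ} {c : ℝ} (f : (Fin 2 → ℕ) → ℝ)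
    (hh : ∀ x, h x ≤ h' x + c) : cornerGrowth n h f ≤ cornerGrowth n h' f + c := by
  induction n with
  | zero => exact hh 0
  | succ n ih =>
    refine ih fun x => ?_
    simp only [growthStep]
    rw [add_right_comm, max_add (h' _) (h' _)]
    exact add_le_add_left (max_le_max (hh _) (hh _)) _

theorem cornerGrowth_const_add {n : ℕ} (c : ℝ) (h : Fin (n + 1) → ℝ) (f : (Fin 2 → ℕ) → ℝ) :
    cornerGrowth n (fun x => c + h x) f = c + cornerGrowth n h f := by
  induction n with
  | zero => rfl
  | succ n ih =>
    rw [cornerGrowth, cornerGrowth, ← ih]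
    congr 1
    ext x
    simp only [growthStep]
    rw [max_add_add_left, add_assoc]

/-- Growth is monotone and commutes with adding constants, hence nonexpansive. This later exchanges
the stationary walk for zero. -/
theorem abs_cornerGrowth_sub_le {n : ℕ} {h : Fin (n + 1) → ℝ} {c : ℝ} (f : (Fin 2 → ℕ) → ℝ)
    (hh : ∀ x, |h x| ≤ c) : |cornerGrowth n h f - maxTotalReward f 0 n| ≤ c := by
  rw [← cornerGrowth_zero, abs_sub_le_iff]
  constructor
  · have := cornerGrowth_le_add (h' := 0) f fun x => by simpa using (le_abs_self _).trans (hh x)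
    linarith
  · have := cornerGrowth_le_add (h := 0) (h' := h) (c := c) f fun x => by
      have := (abs_le.1 (hh x)).1
      simp only [Pi.zero_apply]
      linarith
    linarith

/-! ### The walk along an antidiagonal and its evolution -/

/-- The walk whose increments are the differences of given pairs. -/
def pairWalk {n : ℕ} (d : Fin n → ℝ × ℝ) : Fin (n + 1) → ℝ :=
  Fin.partialSum fun i => (d i).1 - (d i).2

/-- The pairs of increments along the next antidiagonal. -/
def incrementStep {n : ℕ} (d : Fin (n + 1) → ℝ × ℝ) (w : Fin (n + 1) → ℝ) : Fin n → ℝ × ℝ :=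
  fun x => ((cornerStep (d x.succ, w x.succ)).1, (cornerStep (d x.castSucc, w x.castSucc)).2)

/-- If `(I', J')` is the corner step at `x`, the new value at `x` is both the old value at `x` plus
`I'` (`hA`) and the old value at `x + 1` plus `J'` (`hB`). Using `hA` at `x + 1` and `hB` at `x`,
the new increment is `I'` at `x + 1` minus `J'` at `x`. -/
theorem growthStep_pairWalk {n : ℕ} (d : Fin (n + 1) → ℝ × ℝ) (w : Fin (n + 1) → ℝ) :
    growthStep (pairWalk d) w =
      fun x => (cornerStep (d 0, w 0)).1 + pairWalk (incrementStep d w) x := by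
  have hs : ∀ x : Fin (n + 1), pairWalk d x.succ = pairWalk d x.castSucc + ((d x).1 - (d x).2) :=
    fun x => Fin.partialSum_succ _ x
  have hA : ∀ x, growthStep (pairWalk d) w x =
      pairWalk d x.castSucc + (cornerStep (d x, w x)).1 := fun x => by
    simp only [growthStep, cornerStep, hs]
    rcases le_total (d x).1 (d x).2 with h | h
    · rw [max_eq_left (by linarith), max_eq_right (by linarith)]
      ring
    · rw [max_eq_right (by linarith), max_eq_left (by linarith)]
      ring
  have hB : ∀ x, growthStep (pairWalk d) w x =
      pairWalk d x.succ + (cornerStep (d x, w x)).2 := fun x => by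
    simp only [growthStep, cornerStep, hs]
    rcases le_total (d x).1 (d x).2 with h | h
    · rw [max_eq_left (by linarith), max_eq_left (by linarith)]
      ring
    · rw [max_eq_right (by linarith), max_eq_right (by linarith)]
      ring
  ext x
  induction x using Fin.induction with
  | zero =>
    rw [hA]
    simp [pairWalk]
  | succ x ih =>
    have h₁ : pairWalk (incrementStep d w) x.succ = pairWalk (incrementStep d w) x.castSucc +
      ((incrementStep d w x).1 - (incrementStep d w x).2) := Fin.partialSum_succ _ x
    rw [h₁, ← add_assoc, ← ih, hA, hB, incrementStep]
    simp only [Fin.succ_castSucc]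
    ring

theorem cornerGrowth_pairWalk_succ {n : ℕ} (d : Fin (n + 1) → ℝ × ℝ) (f : (Fin 2 → ℕ) → ℝ) :
    cornerGrowth (n + 1) (pairWalk d) f = (cornerStep (d 0, antidiagonalRow f n 0)).1 +
      cornerGrowth n (pairWalk (incrementStep d (antidiagonalRow f n))) f := by
  rw [cornerGrowth, growthStep_pairWalk, cornerGrowth_const_add]

theorem measurable_cornerGrowth (n : ℕ) : Measurable fun q : (Fin (n + 1) → ℝ) ×
    ((Fin 2 → ℕ) → ℝ) => cornerGrowth n q.1 q.2 := by
  induction n with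
  | zero => exact (measurable_pi_apply 0).comp measurable_fst
  | succ n ih =>
    refine ih.comp (Measurable.prodMk ?_ measurable_snd)
    simp only [antidiagonalRow]
    fun_prop

theorem measurable_pairWalk (n : ℕ) : Measurable (pairWalk (n := n)) := by
  refine measurable_pi_lambda _ fun x => ?_
  induction x using Fin.induction with
  | zero => simp [pairWalk]
  | succ x ih =>
    have : (fun d => pairWalk d x.succ) =
        fun d : Fin n → ℝ × ℝ => pairWalk d x.castSucc + ((d x).1 - (d x).2) :=
      funext fun d => Fin.partialSum_succ _ x
    rw [this]
    fun_prop

theorem integrable_cornerGrowth {α : Type*} [MeasurableSpace α] {μ : Measure α} {n : ℕ}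
    {h : α → Fin (n + 1) → ℝ} {f : α → (Fin 2 → ℕ) → ℝ}
    (hh : ∀ x, Integrable (fun a => h a x) μ) (hf : ∀ v, Integrable (fun a => f a v) μ) :
    Integrable (fun a => cornerGrowth n (h a) (f a)) μ := by
  induction n with
  | zero => exact hh 0
  | succ n ih => exact ih fun x => ((hh _).sup (hh _)).add (hf _)

theorem integrable_pairWalk {α : Type*} [MeasurableSpace α] {μ : Measure α} {n : ℕ}
    {d : α → Fin n → ℝ × ℝ} (h₁ : ∀ x, Integrable (fun a => (d a x).1) μ)
    (h₂ : ∀ x, Integrable (fun a => (d a x).2) μ) (x : Fin (n + 1)) :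
    Integrable (fun a => pairWalk (d a) x) μ := by
  induction x using Fin.induction with
  | zero => simp [pairWalk]
  | succ x ih =>
    have : (fun a => pairWalk (d a) x.succ) =
        fun a => pairWalk (d a) x.castSucc + ((d a x).1 - (d a x).2) :=
      funext fun a => Fin.partialSum_succ _ x
    rw [this]
    exact ih.add ((h₁ x).sub (h₂ x))

/-- Corners at distinct sites are independent, so all outputs `I'`, `J'` are i.i.d. with law `κ`.
The new pairs only regroup them, discarding the first `I'` (`e₄`) and the last `J'` (`e₅`). -/
theorem measurePreserving_incrementStep {κ ν : Measure ℝ} [IsProbabilityMeasure κ]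
    [IsProbabilityMeasure ν]
    (hB : MeasurePreserving cornerStep ((κ.prod κ).prod ν) (κ.prod κ)) (n : ℕ) :
    MeasurePreserving (fun q : (Fin (n + 1) → ℝ × ℝ) × (Fin (n + 1) → ℝ) => incrementStep q.1 q.2)
      ((Measure.pi fun _ => κ.prod κ).prod (Measure.pi fun _ => ν))
      (Measure.pi fun _ => κ.prod κ) := by
  have e₁ := (measurePreserving_arrowProdEquivProdArrow (ℝ × ℝ) ℝ (Fin (n + 1))
    (fun _ => κ.prod κ) (fun _ => ν)).symm
  have e₂ := measurePreserving_pi (fun _ : Fin (n + 1) => (κ.prod κ).prod ν)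
    (fun _ => κ.prod κ) fun _ => hB
  have e₃ := measurePreserving_arrowProdEquivProdArrow ℝ ℝ (Fin (n + 1)) (fun _ => κ) (fun _ => κ)
  have e₄ : MeasurePreserving (fun (w : Fin (n + 1) → ℝ) (x : Fin n) => w x.succ)
      (Measure.pi fun _ => κ) (Measure.pi fun _ => κ) :=
    measurePreserving_snd.comp (measurePreserving_piFinSuccAbove (fun _ : Fin (n + 1) => κ) 0)
  have e₅ : MeasurePreserving (fun (w : Fin (n + 1) → ℝ) (x : Fin n) => w x.castSucc)
      (Measure.pi fun _ => κ) (Measure.pi fun _ => κ) := by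
    have := measurePreserving_snd.comp
      (measurePreserving_piFinSuccAbove (fun _ : Fin (n + 1) => κ) (Fin.last n))
    convert this using 1
    ext w x
    simp [MeasurableEquiv.piFinSuccAbove, Fin.init]
  have e₆ := (measurePreserving_arrowProdEquivProdArrow ℝ ℝ (Fin n) (fun _ => κ) (fun _ => κ)).symm
  exact e₆.comp ((e₄.prod e₅).comp (e₃.comp (e₂.comp e₁)))

/-! ### Independence of an antidiagonal from the field below it -/

/-- The part of a reward field that lies below the `n`-th antidiagonal. -/
def fieldBelow (n : ℕ) (f : (Fin 2 → ℕ) → ℝ) : (Fin 2 → ℕ) → ℝ :=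
  fun v => if v 0 + v 1 < n then f v else 0

theorem measurable_fieldBelow (n : ℕ) : Measurable (fieldBelow n) := by
  refine measurable_pi_lambda _ fun v => ?_
  unfold fieldBelow
  split_ifs <;> fun_prop

theorem measurable_antidiagonalRow (n : ℕ) : Measurable fun f => antidiagonalRow f n := by
  unfold antidiagonalRow
  fun_prop

theorem finite_setOf_add_lt (n : ℕ) : {v : Fin 2 → ℕ | v 0 + v 1 < n}.Finite := by
  refine (Set.Finite.pi' fun _ : Fin 2 => Set.finite_Iio n).subset fun v hv i => ?_
  simp only [Set.mem_ofPred_eq] at hv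
  fin_cases i <;> simp <;> omega

theorem measurePreserving_row_fieldBelow (ν : Measure ℝ) [IsProbabilityMeasure ν] (n : ℕ) :
    MeasurePreserving (fun f => (antidiagonalRow f n, fieldBelow n f))
      (Measure.infinitePi fun _ : Fin 2 → ℕ => ν)
      ((Measure.pi fun _ => ν).prod
        ((Measure.infinitePi fun _ : Fin 2 → ℕ => ν).map (fieldBelow n))) := by
  classical
  refine ⟨(measurable_antidiagonalRow n).prodMk (measurable_fieldBelow n), ?_⟩
  have hrow : (Measure.infinitePi fun _ : Fin 2 → ℕ => ν).map (fun f => antidiagonalRow f n) =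
      Measure.pi fun _ => ν := by
    rw [← Measure.infinitePi_eq_pi]
    refine Measure.map_infinitePi_infinitePi_of_inj (P := fun _ : Fin 2 → ℕ => ν)
      (f := fun x : Fin (n + 1) => ![(x : ℕ), n - x]) fun x y hxy => ?_
    exact Fin.ext (congrFun hxy 0)
  rw [← hrow]
  refine (indepFun_iff_map_prod_eq_prod_map_map (measurable_antidiagonalRow n).aemeasurable
    (measurable_fieldBelow n).aemeasurable).1 ?_
  have hind : iIndepFun (fun (v : Fin 2 → ℕ) (f : (Fin 2 → ℕ) → ℝ) => f v)
      (Measure.infinitePi fun _ : Fin 2 → ℕ => ν) :=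
    iIndepFun_infinitePi (X := fun _ x => x) fun _ => measurable_id
  -- Both maps factor through finitely many coordinates: `S` is the antidiagonal and `T` the
  -- triangle below it, which are disjoint.
  let S : Finset (Fin 2 → ℕ) := Finset.univ.image fun x : Fin (n + 1) => ![(x : ℕ), n - x]
  let T : Finset (Fin 2 → ℕ) := (finite_setOf_add_lt n).toFinset
  have hST : Disjoint S T := by
    rw [Finset.disjoint_left]
    intro v hv hv'
    obtain ⟨x, -, rfl⟩ := Finset.mem_image.1 hv
    have : (x : ℕ) + (n - x) < n := by simpa [T] using hv'
    omega
  have h := hind.indepFun_finset S T hST fun v => measurable_pi_apply v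
  let φ : (S → ℝ) → Fin (n + 1) → ℝ := fun g x =>
    g ⟨![(x : ℕ), n - x], Finset.mem_image_of_mem _ (Finset.mem_univ x)⟩
  let ψ : (T → ℝ) → (Fin 2 → ℕ) → ℝ := fun g v => if hv : v ∈ T then g ⟨v, hv⟩ else 0
  have hφ : Measurable φ := by fun_prop
  have hψ : Measurable ψ := by
    refine measurable_pi_lambda _ fun v => ?_
    simp only [ψ]
    split_ifs <;> fun_prop
  have hψ' : fieldBelow n = ψ ∘ fun f (i : T) => f i := by
    ext f v
    simp [fieldBelow, ψ, T]
  rw [hψ']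
  exact h.comp hφ hψ

theorem integral_comp_of_measurePreserving {α β : Type*} [MeasurableSpace α] [MeasurableSpace β]
    {μ : Measure α} {ν : Measure β} {φ : α → β} (hφ : MeasurePreserving φ μ ν) {g : β → ℝ}
    (hg : Measurable g) : ∫ a, g (φ a) ∂μ = ∫ b, g b ∂ν := by
  rw [← hφ.map_eq, integral_map hφ.aemeasurable hg.aestronglyMeasurable]

/-! ### Exact expected growth from the stationary walk -/

section Expectation

variable {κ ν : Measure ℝ} [IsProbabilityMeasure κ] [IsProbabilityMeasure ν]

/-- The law of the increments along an antidiagonal and of an i.i.d. reward field. -/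
noncomputable def stationaryLaw (κ ν : Measure ℝ) (n : ℕ) :
    Measure ((Fin n → ℝ × ℝ) × ((Fin 2 → ℕ) → ℝ)) :=
  (Measure.pi fun _ => κ.prod κ).prod (Measure.infinitePi fun _ => ν)

instance (n : ℕ) : IsProbabilityMeasure (stationaryLaw κ ν n) := by
  unfold stationaryLaw
  infer_instance

theorem measurePreserving_stationaryLaw_fst (n : ℕ) (x : Fin n) :
    MeasurePreserving (fun q : (Fin n → ℝ × ℝ) × ((Fin 2 → ℕ) → ℝ) => q.1 x)
      (stationaryLaw κ ν n) (κ.prod κ) :=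
  (measurePreserving_eval (fun _ : Fin n => κ.prod κ) x).comp measurePreserving_fst

theorem measurePreserving_stationaryLaw_snd (n : ℕ) (v : Fin 2 → ℕ) :
    MeasurePreserving (fun q : (Fin n → ℝ × ℝ) × ((Fin 2 → ℕ) → ℝ) => q.2 v)
      (stationaryLaw κ ν n) ν :=
  (measurePreserving_eval_infinitePi (fun _ => ν) v).comp measurePreserving_snd

theorem integrable_pairWalk_stationaryLaw (hκ : Integrable (fun x => x) κ) (n : ℕ)
    (x : Fin (n + 1)) : Integrable (fun q => pairWalk q.1 x) (stationaryLaw κ ν n) :=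
  integrable_pairWalk
    (fun x => ((measurePreserving_fst (μ := κ) (ν := κ)).comp
      (measurePreserving_stationaryLaw_fst (ν := ν) n x)).integrable_comp_of_integrable hκ)
    (fun x => ((measurePreserving_snd (μ := κ) (ν := κ)).comp
      (measurePreserving_stationaryLaw_fst (ν := ν) n x)).integrable_comp_of_integrable hκ) x

theorem integrable_cornerGrowth_pairWalk (hκ : Integrable (fun x => x) κ)
    (hν : Integrable (fun x => x) ν) (n : ℕ) :
    Integrable (fun q => cornerGrowth n (pairWalk q.1) q.2) (stationaryLaw κ ν n) :=
  integrable_cornerGrowth (integrable_pairWalk_stationaryLaw hκ n) fun v =>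
    (measurePreserving_stationaryLaw_snd n v).integrable_comp_of_integrable hν

theorem measurePreserving_corner_stationaryLaw
    (hB : MeasurePreserving cornerStep ((κ.prod κ).prod ν) (κ.prod κ)) (n : ℕ) :
    MeasurePreserving (fun q : (Fin (n + 1) → ℝ × ℝ) × ((Fin 2 → ℕ) → ℝ) =>
      (cornerStep (q.1 0, antidiagonalRow q.2 n 0)).1) (stationaryLaw κ ν (n + 1)) κ :=
  measurePreserving_fst.comp (hB.comp
    ((measurePreserving_eval (fun _ : Fin (n + 1) => κ.prod κ) 0).prod
      (measurePreserving_eval_infinitePi (fun _ : Fin 2 → ℕ => ν) ![((0 : Fin (n + 1)) : ℕ),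
        n - (0 : Fin (n + 1))])))

theorem measurePreserving_step_fieldBelow
    (hB : MeasurePreserving cornerStep ((κ.prod κ).prod ν) (κ.prod κ)) (n : ℕ) :
    MeasurePreserving (fun q : (Fin (n + 1) → ℝ × ℝ) × ((Fin 2 → ℕ) → ℝ) =>
      (incrementStep q.1 (antidiagonalRow q.2 n), fieldBelow n q.2)) (stationaryLaw κ ν (n + 1))
      ((Measure.pi fun _ => κ.prod κ).prod
        ((Measure.infinitePi fun _ : Fin 2 → ℕ => ν).map (fieldBelow n))) := by
  have : IsProbabilityMeasure
      ((Measure.infinitePi fun _ : Fin 2 → ℕ => ν).map (fieldBelow n)) :=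
    Measure.isProbabilityMeasure_map (measurable_fieldBelow n).aemeasurable
  have e₁ := (MeasurePreserving.id (Measure.pi fun _ : Fin (n + 1) => κ.prod κ)).prod
    (measurePreserving_row_fieldBelow ν n)
  have e₂ := (measurePreserving_prodAssoc (Measure.pi fun _ : Fin (n + 1) => κ.prod κ)
    (Measure.pi fun _ : Fin (n + 1) => ν)
    ((Measure.infinitePi fun _ : Fin 2 → ℕ => ν).map (fieldBelow n))).symm
  have e₃ := (measurePreserving_incrementStep hB n).prod
    (MeasurePreserving.id ((Measure.infinitePi fun _ : Fin 2 → ℕ => ν).map (fieldBelow n)))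
  exact e₃.comp (e₂.comp e₁)

theorem cornerGrowth_fieldBelow {n : ℕ} (h : Fin (n + 1) → ℝ) (f : (Fin 2 → ℕ) → ℝ) :
    cornerGrowth n h (fieldBelow n f) = cornerGrowth n h f :=
  cornerGrowth_congr h fun v hv => by simp [fieldBelow, hv]

/-- With a stationary terminal walk, the expected growth per antidiagonal is the mean of `κ`. -/
theorem integral_cornerGrowth_pairWalk
    (hB : MeasurePreserving cornerStep ((κ.prod κ).prod ν) (κ.prod κ))
    (hκ : Integrable (fun x => x) κ) (hν : Integrable (fun x => x) ν) (n : ℕ) :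
    ∫ q, cornerGrowth n (pairWalk q.1) q.2 ∂(stationaryLaw κ ν n) = n * ∫ x, x ∂κ := by
  induction n with
  | zero => simp [cornerGrowth, pairWalk]
  | succ n ih =>
    have hG : Measurable fun q : (Fin n → ℝ × ℝ) × ((Fin 2 → ℕ) → ℝ) =>
        cornerGrowth n (pairWalk q.1) q.2 :=
      (measurable_cornerGrowth n).comp
        (((measurable_pairWalk n).comp measurable_fst).prodMk measurable_snd)
    have hc := measurePreserving_corner_stationaryLaw hB n
    have h₁ : ∫ q, (cornerStep (q.1 0, antidiagonalRow q.2 n 0)).1 ∂(stationaryLaw κ ν (n + 1)) =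
        ∫ x, x ∂κ := integral_comp_of_measurePreserving hc measurable_id
    -- The maps in `hs` and `hp` have the same image law, and the remaining growth ignores the
    -- rewards erased by `fieldBelow`. So the expectation after one step is that of the stationary
    -- system of size `n`.
    have hs := measurePreserving_step_fieldBelow hB n
    have hp : MeasurePreserving (fun q : (Fin n → ℝ × ℝ) × ((Fin 2 → ℕ) → ℝ) =>
        (q.1, fieldBelow n q.2)) (stationaryLaw κ ν n)
        ((Measure.pi fun _ => κ.prod κ).prod
          ((Measure.infinitePi fun _ : Fin 2 → ℕ => ν).map (fieldBelow n))) :=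
      (MeasurePreserving.id _).prod ⟨measurable_fieldBelow n, rfl⟩
    have h₂ : ∫ q, cornerGrowth n (pairWalk (incrementStep q.1 (antidiagonalRow q.2 n))) q.2
        ∂(stationaryLaw κ ν (n + 1)) = n * ∫ x, x ∂κ := by
      have e₁ := integral_comp_of_measurePreserving hs hG
      have e₂ := integral_comp_of_measurePreserving hp hG
      simp only [cornerGrowth_fieldBelow] at e₁ e₂
      rw [e₁, ← e₂, ih]
    have hi₁ : Integrable (fun q : (Fin (n + 1) → ℝ × ℝ) × ((Fin 2 → ℕ) → ℝ) =>
        (cornerStep (q.1 0, antidiagonalRow q.2 n 0)).1) (stationaryLaw κ ν (n + 1)) :=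
      hc.integrable_comp_of_integrable hκ
    have hi := integrable_cornerGrowth_pairWalk hκ hν (n + 1)
    have hi₂ := hi.sub hi₁
    simp only [cornerGrowth_pairWalk_succ, Pi.sub_def, add_sub_cancel_left] at hi₂
    simp only [cornerGrowth_pairWalk_succ]
    rw [integral_add hi₁ hi₂, h₁, h₂]
    push_cast
    ring

end Expectation

/-! ### Expected maximum modulus of the walk -/

section Maximum

variable {κ : Measure ℝ}

theorem integral_exp_mul_sub [SFinite κ] (s : ℝ) : ∫ p : ℝ × ℝ, Real.exp (s * (p.1 - p.2)) ∂(κ.prod κ) =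
    mgf (fun x => x) κ s * mgf (fun x => x) κ (-s) := by
  rw [mgf, mgf, ← integral_prod_mul]
  congr 1 with p
  rw [← Real.exp_add]
  ring_nf

theorem integrable_exp_mul_sub [SFinite κ] {s : ℝ} (h₁ : s ∈ integrableExpSet (fun x => x) κ)
    (h₂ : -s ∈ integrableExpSet (fun x => x) κ) :
    Integrable (fun p : ℝ × ℝ => Real.exp (s * (p.1 - p.2))) (κ.prod κ) := by
  convert! Integrable.mul_prod h₁ h₂ using 2 with p
  rw [← Real.exp_add]
  ring_nf

variable [IsProbabilityMeasure κ]

/-- The product is the exponential moment of a centred difference, and `exp y ≥ 1 + y`. It lets the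
moment at any site `x ≤ n` be bounded by the `n`-th power. -/
theorem one_le_mgf_mul_mgf_neg {s : ℝ} (hκ : Integrable (fun x => x) κ)
    (h₁ : s ∈ integrableExpSet (fun x => x) κ) (h₂ : -s ∈ integrableExpSet (fun x => x) κ) :
    1 ≤ mgf (fun x => x) κ s * mgf (fun x => x) κ (-s) := by
  rw [← integral_exp_mul_sub]
  have hf : Integrable (fun p : ℝ × ℝ => p.1) (κ.prod κ) := hκ.comp_fst κ
  have hs : Integrable (fun p : ℝ × ℝ => p.2) (κ.prod κ) := hκ.comp_snd κ
  have hd : Integrable (fun p : ℝ × ℝ => p.1 - p.2) (κ.prod κ) := hf.sub hs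
  have hi : Integrable (fun p : ℝ × ℝ => 1 + s * (p.1 - p.2)) (κ.prod κ) :=
    (integrable_const _).add (hd.const_mul s)
  have h0 : ∫ p : ℝ × ℝ, (1 + s * (p.1 - p.2)) ∂(κ.prod κ) = 1 := by
    rw [integral_add (integrable_const _) (hd.const_mul s), integral_const_mul,
      integral_sub hf hs, integral_fun_fst (fun x => x), integral_fun_snd (fun x => x)]
    simp
  rw [← h0]
  refine integral_mono hi (integrable_exp_mul_sub h₁ h₂) fun p => ?_
  simp only
  linarith [Real.add_one_le_exp (s * (p.1 - p.2))]

theorem exp_mul_pairWalk {n : ℕ} (s : ℝ) (x : Fin (n + 1)) (d : Fin n → ℝ × ℝ) :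
    Real.exp (s * pairWalk d x) =
      ∏ i : Fin n, if i.castSucc < x then Real.exp (s * ((d i).1 - (d i).2)) else 1 := by
  induction x using Fin.induction with
  | zero => simp [pairWalk]
  | succ x ih =>
    have h₁ : pairWalk d x.succ = pairWalk d x.castSucc + ((d x).1 - (d x).2) :=
      Fin.partialSum_succ _ x
    rw [h₁, mul_add, Real.exp_add, ih, ← Finset.mul_prod_erase _ _ (Finset.mem_univ x),
      ← Finset.mul_prod_erase (a := x) _ _ (Finset.mem_univ x)]
    simp only [lt_self_iff_false, if_false, one_mul, Fin.castSucc_lt_succ, if_true]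
    rw [mul_comm]
    congr 1
    refine Finset.prod_congr rfl fun i hi => ?_
    have hne := Finset.ne_of_mem_erase hi
    have : i.castSucc < x.castSucc ↔ i.castSucc < x.succ := by
      simp only [Fin.lt_def, Fin.val_castSucc, Fin.val_succ]
      have := fun h => hne (Fin.ext h)
      omega
    simp only [this]

theorem integrable_exp_mul_pairWalk {s : ℝ} (h₁ : s ∈ integrableExpSet (fun x => x) κ)
    (h₂ : -s ∈ integrableExpSet (fun x => x) κ) {n : ℕ} (x : Fin (n + 1)) :
    Integrable (fun d : Fin n → ℝ × ℝ => Real.exp (s * pairWalk d x))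
      (Measure.pi fun _ => κ.prod κ) := by
  simp only [exp_mul_pairWalk]
  refine Integrable.fintype_prod (μ := fun _ : Fin n => κ.prod κ)
    (f := fun (i : Fin n) (p : ℝ × ℝ) =>
      if i.castSucc < x then Real.exp (s * (p.1 - p.2)) else 1) fun i => ?_
  split_ifs
  · exact integrable_exp_mul_sub h₁ h₂
  · exact integrable_const 1

theorem integral_exp_mul_pairWalk_le {s : ℝ} (hκ : Integrable (fun x => x) κ)
    (h₁ : s ∈ integrableExpSet (fun x => x) κ) (h₂ : -s ∈ integrableExpSet (fun x => x) κ)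
    {n : ℕ} (x : Fin (n + 1)) :
    ∫ d : Fin n → ℝ × ℝ, Real.exp (s * pairWalk d x) ∂(Measure.pi fun _ => κ.prod κ) ≤
      (mgf (fun x => x) κ s * mgf (fun x => x) κ (-s)) ^ n := by
  have hM := one_le_mgf_mul_mgf_neg hκ h₁ h₂
  simp only [exp_mul_pairWalk]
  rw [integral_fintype_prod_eq_prod (μ := fun _ : Fin n => κ.prod κ)
    (fun (i : Fin n) (p : ℝ × ℝ) => if i.castSucc < x then Real.exp (s * (p.1 - p.2)) else 1)]
  refine (Finset.prod_le_prod (g := fun _ => mgf (fun x => x) κ s * mgf (fun x => x) κ (-s))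
    (fun i _ => integral_nonneg fun p => ?_) fun i _ => ?_).trans_eq (by simp)
  · dsimp only
    split_ifs <;> positivity
  · split_ifs
    · rw [integral_exp_mul_sub]
    · simpa using hM

/-- An integrable bound for the maximum modulus of the walk. -/
noncomputable def walkBound {n : ℕ} (t C : ℝ) (d : Fin n → ℝ × ℝ) : ℝ :=
  t⁻¹ * (C + Real.exp (-C) *
    ∑ x, (Real.exp (t * pairWalk d x) + Real.exp (-t * pairWalk d x)))

/-- This is `1 + y ≤ exp y` at `y = t * |pairWalk d x| - C`, with the exponential bounded by the sum
over all sites and both signs. -/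
theorem abs_pairWalk_le_walkBound {n : ℕ} {t : ℝ} (ht : 0 < t) (C : ℝ) (d : Fin n → ℝ × ℝ)
    (x : Fin (n + 1)) : |pairWalk d x| ≤ walkBound t C d := by
  have h₁ : Real.exp (t * |pairWalk d x|) ≤
      Real.exp (t * pairWalk d x) + Real.exp (-t * pairWalk d x) := by
    rcases abs_choice (pairWalk d x) with h | h <;> rw [h]
    · exact le_add_of_nonneg_right (Real.exp_pos _).le
    · rw [mul_neg, ← neg_mul]
      exact le_add_of_nonneg_left (Real.exp_pos _).le
  have h₂ := Finset.single_le_sum (f := fun x => Real.exp (t * pairWalk d x) +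
    Real.exp (-t * pairWalk d x)) (fun i _ => by positivity) (Finset.mem_univ x)
  have h₃ := Real.add_one_le_exp (-C + t * |pairWalk d x|)
  rw [Real.exp_add] at h₃
  have h₄ := mul_le_mul_of_nonneg_left (h₁.trans h₂) (Real.exp_pos (-C)).le
  rw [walkBound, le_inv_mul_iff₀ ht]
  linarith

theorem integrable_walkBound {t : ℝ} (C : ℝ) (h₁ : t ∈ integrableExpSet (fun x => x) κ)
    (h₂ : -t ∈ integrableExpSet (fun x => x) κ) (n : ℕ) :
    Integrable (fun d : Fin n → ℝ × ℝ => walkBound t C d) (Measure.pi fun _ => κ.prod κ) :=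
  ((integrable_const C).add ((integrable_finsetSum _ fun x _ =>
    (integrable_exp_mul_pairWalk h₁ h₂ x).add (integrable_exp_mul_pairWalk h₂
      (by rwa [neg_neg]) x)).const_mul _)).const_mul _

theorem integral_walkBound_le {t : ℝ} (ht : 0 < t) (hκ : Integrable (fun x => x) κ)
    (h₁ : t ∈ integrableExpSet (fun x => x) κ) (h₂ : -t ∈ integrableExpSet (fun x => x) κ) (n : ℕ) :
    ∃ C, ∫ d : Fin n → ℝ × ℝ, walkBound t C d ∂(Measure.pi fun _ => κ.prod κ) ≤
      t⁻¹ * (Real.log (2 * (n + 1)) + n * (cgf (fun x => x) κ t + cgf (fun x => x) κ (-t)) + 1) := by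
  set ψ := cgf (fun x => x) κ t + cgf (fun x => x) κ (-t) with hψ
  have hM : mgf (fun x => x) κ t * mgf (fun x => x) κ (-t) = Real.exp ψ := by
    rw [hψ, Real.exp_add, exp_cgf h₁, exp_cgf h₂]
  have h₂' : - -t ∈ integrableExpSet (fun x => x) κ := by rwa [neg_neg]
  have hi : ∀ x : Fin (n + 1), Integrable (fun d : Fin n → ℝ × ℝ => Real.exp (t * pairWalk d x) +
      Real.exp (-t * pairWalk d x)) (Measure.pi fun _ => κ.prod κ) := fun x =>
    (integrable_exp_mul_pairWalk h₁ h₂ x).add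
    (integrable_exp_mul_pairWalk h₂ h₂' x)
  -- `C` is the logarithm of the bound `2 * (n + 1) * exp (n * ψ)` for the expected sum over `n + 1`
  -- sites and two signs; the exponential term then contributes at most `1`.
  refine ⟨Real.log (2 * (n + 1)) + n * ψ, ?_⟩
  have hsum : ∫ d : Fin n → ℝ × ℝ, ∑ x, (Real.exp (t * pairWalk d x) +
      Real.exp (-t * pairWalk d x)) ∂(Measure.pi fun _ => κ.prod κ) ≤
      2 * (n + 1) * Real.exp (n * ψ) := by
    rw [integral_finsetSum _ fun x _ => hi x]
    have : ∀ x ∈ (Finset.univ : Finset (Fin (n + 1))), ∫ d : Fin n → ℝ × ℝ,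
        (Real.exp (t * pairWalk d x) + Real.exp (-t * pairWalk d x))
        ∂(Measure.pi fun _ => κ.prod κ) ≤ 2 * Real.exp (n * ψ) := by
      intro x _
      rw [integral_add (integrable_exp_mul_pairWalk h₁ h₂ x) (integrable_exp_mul_pairWalk h₂ h₂' x)]
      have e₁ := integral_exp_mul_pairWalk_le hκ h₁ h₂ x
      have e₂ := integral_exp_mul_pairWalk_le hκ h₂ h₂' x
      rw [neg_neg, mul_comm] at e₂
      rw [hM, ← Real.exp_nat_mul] at e₁
      rw [hM, ← Real.exp_nat_mul] at e₂
      linarith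
    refine (Finset.sum_le_sum this).trans_eq ?_
    simp
    ring
  unfold walkBound
  rw [integral_const_mul, integral_add (integrable_const _)
    ((integrable_finsetSum _ fun x _ => hi x).const_mul _), integral_const_mul]
  simp only [integral_const, probReal_univ, one_smul]
  have hlog : Real.exp (-(Real.log (2 * (n + 1)) + n * ψ)) * (2 * (n + 1) * Real.exp (n * ψ)) =
      1 := by
    have h0 : (0 : ℝ) < 2 * (n + 1) := by positivity
    nth_rewrite 2 [← Real.exp_log h0]
    rw [← Real.exp_add, ← Real.exp_add]
    simp
  have := mul_le_mul_of_nonneg_left hsum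
    (Real.exp_pos (-(Real.log (2 * (n + 1)) + n * ψ))).le
  rw [hlog] at this
  gcongr

end Maximum

/-- The function is even, so the two derivatives cancel; this gives `ψ t = o(t)`. -/
theorem hasDerivAt_cgf_add_cgf_neg {κ : Measure ℝ}
    (h : 0 ∈ interior (integrableExpSet (fun x => x) κ)) :
    HasDerivAt (fun t => cgf (fun x => x) κ t + cgf (fun x => x) κ (-t)) 0 0 := by
  have h₁ := (analyticAt_cgf h).differentiableAt.hasDerivAt
  have h₂ : HasDerivAt (cgf (fun x => x) κ) (deriv (cgf (fun x => x) κ) 0) (-0) := by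
    rwa [neg_zero]
  have h₃ := h₁.add (h₂.comp 0 (hasDerivAt_neg (0 : ℝ)))
  convert! h₃ using 1
  ring

/-! ### Comparison with zero terminal values and the limit -/

section Limit

variable {κ ν : Measure ℝ} [IsProbabilityMeasure κ] [IsProbabilityMeasure ν]

theorem measurable_maxTotalReward (n : ℕ) :
    Measurable fun f : (Fin 2 → ℕ) → ℝ => maxTotalReward f 0 n := by
  simp only [← cornerGrowth_zero]
  exact (measurable_cornerGrowth n).comp (measurable_const.prodMk measurable_id)

theorem integrable_maxTotalReward (hν : Integrable (fun x => x) ν) (n : ℕ) :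
    Integrable (fun f => maxTotalReward f 0 n) (Measure.infinitePi fun _ : Fin 2 → ℕ => ν) := by
  simp only [← cornerGrowth_zero]
  exact integrable_cornerGrowth (fun x => integrable_const 0) fun v =>
    (measurePreserving_eval_infinitePi (fun _ => ν) v).integrable_comp_of_integrable hν

theorem abs_integral_maxTotalReward_sub_le
    (hB : MeasurePreserving cornerStep ((κ.prod κ).prod ν) (κ.prod κ))
    (hκ : Integrable (fun x => x) κ) (hν : Integrable (fun x => x) ν) {t : ℝ} (ht : 0 < t)
    (h₁ : t ∈ integrableExpSet (fun x => x) κ) (h₂ : -t ∈ integrableExpSet (fun x => x) κ) (n : ℕ) :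
    |∫ f, maxTotalReward f 0 n ∂(Measure.infinitePi fun _ : Fin 2 → ℕ => ν) - n * ∫ x, x ∂κ| ≤
      t⁻¹ * (Real.log (2 * (n + 1)) + n * (cgf (fun x => x) κ t + cgf (fun x => x) κ (-t)) + 1) := by
  obtain ⟨C, hC⟩ := integral_walkBound_le ht hκ h₁ h₂ n
  have hsnd : MeasurePreserving Prod.snd (stationaryLaw κ ν n)
      (Measure.infinitePi fun _ : Fin 2 → ℕ => ν) := measurePreserving_snd
  have hfst : MeasurePreserving Prod.fst (stationaryLaw κ ν n)
      (Measure.pi fun _ => κ.prod κ) := measurePreserving_fst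
  have hT : Integrable (fun q => maxTotalReward q.2 0 n) (stationaryLaw κ ν n) :=
    hsnd.integrable_comp_of_integrable (integrable_maxTotalReward hν n)
  have hG := integrable_cornerGrowth_pairWalk hκ hν n
  have hb : Integrable (fun q => walkBound t C q.1) (stationaryLaw κ ν n) :=
    hfst.integrable_comp_of_integrable (integrable_walkBound C h₁ h₂ n)
  have hbi : ∫ q, walkBound t C q.1 ∂(stationaryLaw κ ν n) =
      ∫ d : Fin n → ℝ × ℝ, walkBound t C d ∂(Measure.pi fun _ => κ.prod κ) := by
    have hm : AEStronglyMeasurable (fun d : Fin n → ℝ × ℝ => walkBound t C d)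
        (Measure.pi fun _ => κ.prod κ) := (integrable_walkBound C h₁ h₂ n).aestronglyMeasurable
    rw [← hfst.map_eq] at hm ⊢
    rw [integral_map hfst.aemeasurable hm]
  rw [← integral_comp_of_measurePreserving hsnd (measurable_maxTotalReward n),
    ← integral_cornerGrowth_pairWalk hB hκ hν n, abs_sub_comm, ← integral_sub hG hT]
  refine (abs_integral_le_integral_abs).trans (le_trans ?_ (hbi.trans_le hC))
  exact integral_mono (hG.sub hT).abs hb fun q =>
    abs_cornerGrowth_sub_le q.2 (abs_pairWalk_le_walkBound ht C q.1)

theorem tendsto_log_add_one_div :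
    Tendsto (fun n : ℕ => (Real.log (2 * (n + 1)) + 1) / n) atTop (𝓝 0) := by
  have h₁ : Tendsto (fun n : ℕ => Real.log n / n) atTop (𝓝 0) :=
    Real.isLittleO_log_id_atTop.tendsto_div_nhds_zero.comp tendsto_natCast_atTop_atTop
  -- The constant `log 4` comes from `2 * (n + 1) ≤ 4 * n` for `n ≥ 1`.
  have h₂ := h₁.add (tendsto_const_div_atTop_nhds_zero_nat (Real.log 4 + 1))
  rw [add_zero] at h₂
  refine tendsto_of_tendsto_of_tendsto_of_le_of_le' tendsto_const_nhds h₂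
    (Eventually.of_forall fun n => ?_) ?_
  · have : 0 ≤ Real.log (2 * (n + 1)) := Real.log_nonneg (by linarith [n.cast_nonneg (α := ℝ)])
    positivity
  · filter_upwards [eventually_ge_atTop 1] with n hn
    have hn' : (1 : ℝ) ≤ n := by exact_mod_cast hn
    rw [← add_div, ← add_assoc, ← Real.log_mul (by positivity) (by norm_num)]
    refine div_le_div_of_nonneg_right (add_le_add_left (Real.log_le_log (by positivity) ?_) _)
      (by positivity)
    linarith

theorem tendsto_integral_maxMeanReward
    (hB : MeasurePreserving cornerStep ((κ.prod κ).prod ν) (κ.prod κ))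
    (h : 0 ∈ interior (integrableExpSet (fun x => x) κ)) (hν : Integrable (fun x => x) ν) :
    Tendsto (fun n : ℕ => ∫ f, maxMeanReward f n ∂(Measure.infinitePi fun _ : Fin 2 → ℕ => ν)) atTop
      (𝓝 (∫ x, x ∂κ)) := by
  have hκ : Integrable (fun x => x) κ := integrable_of_mem_interior_integrableExpSet h
  rw [Metric.tendsto_nhds]
  intro ε hε
  -- A `t > 0` with `ψ t ≤ (ε / 2) * t` is fixed before `n`; the logarithmic term then vanishes as
  -- `n` grows.
  have ho := (hasDerivAt_iff_isLittleO_nhds_zero.1 (hasDerivAt_cgf_add_cgf_neg h)).def (half_pos hε)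
  have hS := mem_interior_iff_mem_nhds.1 h
  have hS' : ∀ᶠ t in 𝓝 (0 : ℝ), -t ∈ integrableExpSet (fun x => x) κ := by
    have : Tendsto (fun t : ℝ => -t) (𝓝 0) (𝓝 0) := by
      simpa using (continuous_neg (G := ℝ)).tendsto 0
    exact this hS
  obtain ⟨t, ⟨⟨ht₁, ht₂⟩, ht₃⟩, ht⟩ := (((ho.and hS).and hS').filter_mono
    nhdsWithin_le_nhds).and (self_mem_nhdsWithin (s := Set.Ioi (0 : ℝ))) |>.exists
  have ht0 : 0 < t := ht
  simp only [zero_add, neg_zero, cgf_zero, smul_zero, sub_zero, Real.norm_eq_abs,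
    add_zero, abs_of_pos ht0] at ht₁
  have hψ := (le_abs_self _).trans ht₁
  have hlim := tendsto_log_add_one_div.const_mul t⁻¹
  rw [mul_zero] at hlim
  filter_upwards [hlim.eventually (gt_mem_nhds (half_pos hε)), eventually_ge_atTop 1] with n hn hn1
  have hn0 : (0 : ℝ) < n := by exact_mod_cast hn1
  have hle := abs_integral_maxTotalReward_sub_le hB hκ hν ht0 ht₂ ht₃ n
  unfold maxMeanReward
  rw [integral_div, Real.dist_eq, div_sub' hn0.ne', abs_div, abs_of_pos hn0, div_lt_iff₀ hn0]
  refine hle.trans_lt ?_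
  rw [← mul_div_assoc, div_lt_iff₀ hn0] at hn
  have h₁ : t⁻¹ * (n * (cgf (fun x => x) κ t + cgf (fun x => x) κ (-t))) ≤ ε / 2 * n := by
    rw [inv_mul_le_iff₀ ht0]
    nlinarith
  calc _ = t⁻¹ * (Real.log (2 * (n + 1)) + 1) +
        t⁻¹ * (n * (cgf (fun x => x) κ t + cgf (fun x => x) κ (-t))) := by ring
    _ < ε * n := by linarith

end Limit

/-! ### Exponential laws -/

section Exponential

/-- Moments and exponential moments are read off from the normalisation of another gamma density,
without computing an integral. -/
theorem integral_expMeasure {b a r c : ℝ} (ha : 0 < a) (hr : 0 < r) (hb : 0 < b)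
    {g : ℝ → ℝ} (h : ∀ x, gammaPDFReal 1 b x * g x = c * gammaPDFReal a r x) :
    Integrable g (expMeasure b) ∧ ∫ x, g x ∂(expMeasure b) = c := by
  have hnn : 0 ≤ᵐ[volume] gammaPDFReal a r := ae_of_all _ fun x => gammaPDFReal_nonneg ha hr x
  have hm := (measurable_gammaPDFReal a r).aestronglyMeasurable (μ := volume)
  have h1 : ∫⁻ x, ENNReal.ofReal (gammaPDFReal a r x) = 1 := lintegral_gammaPDF_eq_one ha hr
  have hi : Integrable (gammaPDFReal a r) :=
    ⟨hm, (hasFiniteIntegral_iff_ofReal hnn).2 (by rw [h1]; exact ENNReal.one_lt_top)⟩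
  have hI : ∫ x, gammaPDFReal a r x = 1 := by
    rw [integral_eq_lintegral_of_nonneg_ae hnn hm, h1, ENNReal.toReal_one]
  have hmeas : Measurable (gammaPDF 1 b) := (measurable_gammaPDFReal 1 b).ennreal_ofReal
  have hlt : ∀ᵐ x, gammaPDF 1 b x < ⊤ := ae_of_all _ fun x => ENNReal.ofReal_lt_top
  have heq : (fun x => (gammaPDF 1 b x).toReal • g x) = fun x => c * gammaPDFReal a r x := by
    ext x
    rw [gammaPDF, ENNReal.toReal_ofReal (gammaPDFReal_nonneg one_pos hb x), smul_eq_mul, h]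
  unfold expMeasure gammaMeasure
  rw [integrable_withDensity_iff_integrable_smul' hmeas hlt,
    integral_withDensity_eq_integral_toReal_smul hmeas hlt, heq, integral_const_mul, hI, mul_one]
  exact ⟨hi.const_mul c, rfl⟩

theorem zero_mem_interior_integrableExpSet_expMeasure {b : ℝ} (hb : 0 < b) :
    0 ∈ interior (integrableExpSet (fun x => x) (expMeasure b)) := by
  refine mem_interior.2 ⟨Set.Iio b, fun s hs => ?_, isOpen_Iio, hb⟩
  have hs' : 0 < b - s := sub_pos.2 hs
  refine (integral_expMeasure (a := 1) (r := b - s) (c := b / (b - s)) one_pos hs' hb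
    fun x => ?_).1
  unfold gammaPDFReal
  split_ifs
  · simp only [Real.rpow_one, Real.Gamma_one, div_one, sub_self, Real.rpow_zero, mul_one]
    rw [mul_assoc, ← Real.exp_add, ← mul_assoc, div_mul_cancel₀ _ hs'.ne']
    ring_nf
  · simp

theorem integral_id_expMeasure {b : ℝ} (hb : 0 < b) : ∫ x, x ∂(expMeasure b) = 1 / b := by
  refine (integral_expMeasure (a := 2) (r := b) two_pos hb hb fun x => ?_).2
  unfold gammaPDFReal
  split_ifs
  · have : Real.Gamma 2 = 1 := Real.Gamma_two
    rw [this, Real.rpow_two, show (2 : ℝ) - 1 = 1 by norm_num]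
    simp only [Real.rpow_one, Real.Gamma_one, div_one, sub_self, Real.rpow_zero, mul_one]
    field_simp
  · simp

theorem integral_sq_expMeasure {b : ℝ} (hb : 0 < b) :
    ∫ x, x ^ 2 ∂(expMeasure b) = 2 / b ^ 2 := by
  refine (integral_expMeasure (a := 3) (r := b) three_pos hb hb fun x => ?_).2
  unfold gammaPDFReal
  split_ifs
  · have : Real.Gamma 3 = 2 := by
      have := Real.Gamma_nat_eq_factorial 2
      rw [show ((2 : ℕ) : ℝ) + 1 = 3 by norm_num] at this
      rw [this]
      norm_num [Nat.factorial]
    rw [this, show (3 : ℝ) - 1 = 2 by norm_num, Real.rpow_two,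
      show b ^ (3 : ℝ) = b ^ 3 by exact_mod_cast Real.rpow_natCast b 3]
    simp only [Real.rpow_one, Real.Gamma_one, div_one, sub_self, Real.rpow_zero, mul_one]
    field_simp
  · simp

theorem variance_expMeasure {b : ℝ} (hb : 0 < b) :
    variance (fun x => x) (expMeasure b) = (1 / b) ^ 2 := by
  have := isProbabilityMeasure_expMeasure hb
  rw [variance_eq_sub (memLp_of_mem_interior_integrableExpSet
    (zero_mem_interior_integrableExpSet_expMeasure hb) 2)]
  simp only [Pi.pow_apply]
  rw [integral_sq_expMeasure hb, integral_id_expMeasure hb]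
  ring

theorem expMeasure_Ici {b : ℝ} (hb : 0 < b) (t : ℝ) :
    expMeasure b (Set.Ici t) = ENNReal.ofReal (Real.exp (-(b * max t 0))) := by
  have := isProbabilityMeasure_expMeasure hb
  have hac : expMeasure b ≪ volume := withDensity_absolutelyContinuous _ _
  have h₁ : expMeasure b (Set.Ici t) = expMeasure b (Set.Ioi t) :=
    measure_congr (hac.ae_le Ioi_ae_eq_Ici.symm)
  rw [h₁, ← Set.compl_Iic, ← ofReal_measureReal, probReal_compl_eq_one_sub measurableSet_Iic,
    ← cdf_eq_real, cdf_expMeasure_eq hb]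
  congr 1
  split_ifs with h
  · rw [max_eq_left h]
    ring
  · rw [max_eq_right (not_le.1 h).le]
    simp

theorem isMemoryless_expMeasure {b : ℝ} (hb : 0 < b) : IsMemoryless (expMeasure b) := by
  have := isProbabilityMeasure_expMeasure hb
  intro t
  -- A negative threshold imposes no condition, so no shift is needed there.
  refine ⟨max t 0, ?_⟩
  have hm : Measurable fun x : ℝ => x - max t 0 := by fun_prop
  refine Measure.ext_of_Ici _ _ fun u => ?_
  have hset : (fun x : ℝ => x - max t 0) ⁻¹' Set.Ici u ∩ Set.Ici t =
      Set.Ici (max (u + max t 0) t) := by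
    ext x
    simp
  rw [Measure.map_apply hm measurableSet_Ici, Measure.restrict_apply (hm measurableSet_Ici), hset,
    Measure.smul_apply, smul_eq_mul, expMeasure_Ici hb, expMeasure_Ici hb, expMeasure_Ici hb,
    ← ENNReal.ofReal_mul (Real.exp_pos _).le, ← Real.exp_add]
  congr 2
  have : max (max (u + max t 0) t) 0 = max t 0 + max u 0 := by
    rcases le_total t 0 with ht | ht <;> rcases le_total u 0 with hu | hu <;> simp [ht, hu]
    · exact ht.trans hu
    · rw [max_eq_left (by linarith), add_comm]
  rw [this]
  ring

theorem expMeasure_Ici_eq_sq {a : ℝ} (ha : 0 < a) (t : ℝ) :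
    expMeasure a (Set.Ici t) = expMeasure (a / 2) (Set.Ici t) ^ 2 := by
  rw [expMeasure_Ici ha, expMeasure_Ici (half_pos ha), ← ENNReal.ofReal_pow (Real.exp_pos _).le,
    ← Real.exp_nat_mul]
  congr 2
  push_cast
  ring

end Exponential

/-! ### Geometric laws -/

section Geometric

/-- The geometric law on `{1, 2, 3, …}`. -/
noncomputable def geometricLaw (p : unitInterval) : Measure ℝ :=
  (geometricMeasure p).map fun k : ℕ => (k : ℝ) + 1

instance (p : unitInterval) : IsProbabilityMeasure (geometricLaw p) :=
  Measure.isProbabilityMeasure_map (measurable_of_countable _).aemeasurable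

variable {p : unitInterval}

theorem integral_geometricLaw (hp : p ≠ 0) {g : ℝ → ℝ} (hg : Measurable g) :
    ∫ x, g x ∂(geometricLaw p) = ∑' n : ℕ, ((1 - p : ℝ) ^ n * p) * g (n + 1) := by
  rw [geometricLaw, integral_map (measurable_of_countable _).aemeasurable hg.aestronglyMeasurable,
    integral_geometricMeasure hp]
  simp

theorem one_sub_mem_Ico (hp : p ≠ 0) : 0 ≤ (1 - p : ℝ) ∧ (1 - p : ℝ) < 1 := by
  have : 0 < (p : ℝ) := unitInterval.pos_iff_ne_zero.2 hp
  exact ⟨sub_nonneg.2 p.2.2, by linarith⟩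

theorem zero_mem_interior_integrableExpSet_geometricLaw (hp : p ≠ 0) :
    0 ∈ interior (integrableExpSet (fun x => x) (geometricLaw p)) := by
  obtain ⟨h0, h1⟩ := one_sub_mem_Ico hp
  refine mem_interior.2 ⟨{s : ℝ | (1 - p : ℝ) * Real.exp s < 1}, fun s hs => ?_,
    isOpen_lt (by fun_prop) continuous_const, by simpa using h1⟩
  have hs' : (1 - p : ℝ) * Real.exp s < 1 := hs
  have hm : Measurable fun x : ℝ => Real.exp (s * x) := by fun_prop
  change Integrable (fun x : ℝ => Real.exp (s * x)) (geometricLaw p)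
  rw [geometricLaw, integrable_map_measure hm.aestronglyMeasurable
    (measurable_of_countable _).aemeasurable, integrable_geometricMeasure_iff hp]
  have := (summable_geometric_of_lt_one (mul_nonneg h0 (Real.exp_pos s).le) hs').mul_left
    ((p : ℝ) * Real.exp s)
  refine this.congr fun n => ?_
  simp only [Function.comp_apply, Real.norm_eq_abs, Real.abs_exp]
  rw [mul_add, mul_one, Real.exp_add, mul_comm s, Real.exp_nat_mul, mul_pow]
  ring

theorem integral_id_geometricLaw (hp : p ≠ 0) : ∫ x, x ∂(geometricLaw p) = 1 / p := by
  obtain ⟨h0, h1⟩ := one_sub_mem_Ico hp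
  have hp0 : (p : ℝ) ≠ 0 := by linarith
  have h := (hasSum_choose_mul_geometric_of_norm_lt_one 1 (r := (1 - p : ℝ))
    (by rwa [Real.norm_of_nonneg h0])).mul_left (p : ℝ)
  rw [integral_geometricLaw hp (g := fun x => x) measurable_id]
  convert h.tsum_eq using 1
  · congr 1 with n
    simp
    ring
  · rw [sub_sub_cancel]
    field_simp

theorem integral_sq_geometricLaw (hp : p ≠ 0) :
    ∫ x, x ^ 2 ∂(geometricLaw p) = (2 - p) / p ^ 2 := by
  obtain ⟨h0, h1⟩ := one_sub_mem_Ico hp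
  have hp0 : (p : ℝ) ≠ 0 := by linarith
  have hn : ‖(1 - p : ℝ)‖ < 1 := by rwa [Real.norm_of_nonneg h0]
  -- Here `(n + 1) ^ 2 = 2 * (n + 2).choose 2 - (n + 1).choose 1`.
  have h := (((hasSum_choose_mul_geometric_of_norm_lt_one 2 hn).mul_left 2).sub
    (hasSum_choose_mul_geometric_of_norm_lt_one 1 hn)).mul_left (p : ℝ)
  rw [integral_geometricLaw hp (g := fun x => x ^ 2) (by fun_prop)]
  convert h.tsum_eq using 1
  · congr 1 with n
    rw [Nat.cast_choose_two]
    simp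
    ring
  · rw [sub_sub_cancel]
    field_simp
    ring

theorem variance_geometricLaw (hp : p ≠ 0) :
    variance (fun x => x) (geometricLaw p) = (1 - p) / p ^ 2 := by
  rw [variance_eq_sub (memLp_of_mem_interior_integrableExpSet
    (zero_mem_interior_integrableExpSet_geometricLaw hp) 2)]
  simp only [Pi.pow_apply]
  rw [integral_sq_geometricLaw hp, integral_id_geometricLaw hp]
  ring

theorem geometricMeasure_Ici (hp : p ≠ 0) (m : ℕ) :
    geometricMeasure p (Set.Ici m) = ENNReal.ofReal ((1 - p : ℝ) ^ m) := by
  rw [← ofReal_measureReal]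
  congr 1
  induction m with
  | zero =>
    have : Set.Ici 0 = (Set.univ : Set ℕ) := by simp
    rw [this]
    simp
  | succ m ih =>
    have hset : Set.Ici m = {m} ∪ Set.Ici (m + 1) := by
      ext k
      simp
      omega
    rw [hset, measureReal_union (by simp) measurableSet_Ici,
      geometricMeasure_real_singleton hp] at ih
    rw [pow_succ]
    linarith

theorem preimage_Ici_add_one (t : ℝ) :
    (fun k : ℕ => (k : ℝ) + 1) ⁻¹' Set.Ici t = Set.Ici ⌈t - 1⌉₊ := by
  ext k
  simp

theorem geometricLaw_Ici (hp : p ≠ 0) (t : ℝ) :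
    geometricLaw p (Set.Ici t) = ENNReal.ofReal ((1 - p : ℝ) ^ ⌈t - 1⌉₊) := by
  rw [geometricLaw, Measure.map_apply (measurable_of_countable _) measurableSet_Ici,
    preimage_Ici_add_one, geometricMeasure_Ici hp]

theorem isMemoryless_geometricLaw (hp : p ≠ 0) : IsMemoryless (geometricLaw p) := by
  intro t
  -- A value `k + 1` reaches `t` exactly when `k ≥ ⌈t - 1⌉₊`, so the shift is this integer, which is
  -- `0` for `t ≤ 1`.
  refine ⟨⌈t - 1⌉₊, ?_⟩
  have hm : Measurable fun x : ℝ => x - ⌈t - 1⌉₊ := by fun_prop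
  refine Measure.ext_of_Ici _ _ fun u => ?_
  have hset : (fun x : ℝ => x - ⌈t - 1⌉₊) ⁻¹' Set.Ici u ∩ Set.Ici t =
      Set.Ici (max (u + ⌈t - 1⌉₊) t) := by
    ext x
    simp
  rw [Measure.map_apply hm measurableSet_Ici, Measure.restrict_apply (hm measurableSet_Ici), hset,
    Measure.smul_apply, smul_eq_mul, geometricLaw_Ici hp, geometricLaw_Ici hp, geometricLaw_Ici hp,
    ← ENNReal.ofReal_mul (pow_nonneg (one_sub_mem_Ico hp).1 _), ← pow_add]
  congr 2
  have ht := Nat.le_ceil (t - 1)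
  have hu := Nat.le_ceil (u - 1)
  have hu0 : (0 : ℝ) ≤ ⌈u - 1⌉₊ := Nat.cast_nonneg _
  apply le_antisymm
  · rw [Nat.ceil_le, sub_le_iff_le_add, max_le_iff]
    push_cast
    constructor <;> linarith
  · have hc := Nat.le_ceil (max (u + ⌈t - 1⌉₊) t - 1)
    rw [sub_le_iff_le_add, max_le_iff] at hc
    have hm : ⌈t - 1⌉₊ ≤ ⌈max (u + ⌈t - 1⌉₊) t - 1⌉₊ := Nat.ceil_le.2 (by linarith)
    refine (Nat.le_sub_iff_add_le' hm).1 (Nat.ceil_le.2 ?_)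
    rw [Nat.cast_sub hm]
    linarith

theorem geometricLaw_Ici_eq_sq {p' : unitInterval} (hp : p ≠ 0) (hp' : p' ≠ 0)
    (h : (1 - p' : ℝ) ^ 2 = 1 - p) (t : ℝ) :
    geometricLaw p (Set.Ici t) = geometricLaw p' (Set.Ici t) ^ 2 := by
  rw [geometricLaw_Ici hp, geometricLaw_Ici hp',
    ← ENNReal.ofReal_pow (pow_nonneg (one_sub_mem_Ico hp').1 _), ← h, pow_right_comm]

end Geometric

/-! ### Choice of the increment law and conclusion -/

theorem exists_memoryless_of_law {ν : Measure ℝ} (hν : IsExponentialLaw ν ∨ IsGeometricLaw ν) :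
    ∃ κ : Measure ℝ, IsProbabilityMeasure κ ∧ IsProbabilityMeasure ν ∧ IsMemoryless κ ∧
      (∀ t, ν (Set.Ici t) = κ (Set.Ici t) ^ 2) ∧
      0 ∈ interior (integrableExpSet (fun x => x) κ) ∧
      0 ∈ interior (integrableExpSet (fun x => x) ν) ∧
      ∫ x, x ∂κ = (∫ x, x ∂ν) + Real.sqrt (variance (fun x : ℝ => x) ν) := by
  rcases hν with ⟨a, ha, rfl⟩ | ⟨p, hp, rfl⟩
  · refine ⟨expMeasure (a / 2), isProbabilityMeasure_expMeasure (half_pos ha),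
      isProbabilityMeasure_expMeasure ha, isMemoryless_expMeasure (half_pos ha),
      expMeasure_Ici_eq_sq ha, zero_mem_interior_integrableExpSet_expMeasure (half_pos ha),
      zero_mem_interior_integrableExpSet_expMeasure ha, ?_⟩
    rw [integral_id_expMeasure ha, integral_id_expMeasure (half_pos ha), variance_expMeasure ha,
      Real.sqrt_sq (by positivity)]
    field_simp
    norm_num
  · obtain ⟨h0, h1⟩ := one_sub_mem_Ico hp
    have hs0 := Real.sqrt_nonneg (1 - p : ℝ)
    have hs1 : Real.sqrt (1 - p : ℝ) < 1 := by rwa [Real.sqrt_lt' one_pos, one_pow]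
    have hsq := Real.sq_sqrt h0
    -- The failure probability `√(1 - p)` squares to `1 - p`, and `1 / p' = (1 + √(1 - p)) / p` is
    -- the mean plus the standard deviation.
    let p' : unitInterval := ⟨1 - Real.sqrt (1 - p), by linarith, by linarith⟩
    have hp'v : (p' : ℝ) = 1 - Real.sqrt (1 - p) := rfl
    have hp' : p' ≠ 0 := by
      rw [← unitInterval.pos_iff_ne_zero, ← unitInterval.coe_pos, hp'v]
      linarith
    change ∃ κ : Measure ℝ, IsProbabilityMeasure κ ∧ IsProbabilityMeasure (geometricLaw p) ∧
      IsMemoryless κ ∧ (∀ t, geometricLaw p (Set.Ici t) = κ (Set.Ici t) ^ 2) ∧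
      0 ∈ interior (integrableExpSet (fun x => x) κ) ∧
      0 ∈ interior (integrableExpSet (fun x => x) (geometricLaw p)) ∧ ∫ x, x ∂κ =
        (∫ x, x ∂(geometricLaw p)) + Real.sqrt (variance (fun x : ℝ => x) (geometricLaw p))
    refine ⟨geometricLaw p', inferInstance, inferInstance, isMemoryless_geometricLaw hp',
      geometricLaw_Ici_eq_sq hp hp' (by rw [hp'v, sub_sub_cancel, hsq]),
      zero_mem_interior_integrableExpSet_geometricLaw hp',
      zero_mem_interior_integrableExpSet_geometricLaw hp, ?_⟩
    rw [integral_id_geometricLaw hp', integral_id_geometricLaw hp, variance_geometricLaw hp,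
      Real.sqrt_div h0, Real.sqrt_sq p.2.1, hp'v]
    have hp0 : (p : ℝ) ≠ 0 := by linarith
    have hq0 : 1 - Real.sqrt (1 - p : ℝ) ≠ 0 := by linarith
    field_simp
    linarith

/-- If the rewards at the vertices of the two-dimensional regular lattice are i.i.d. with an
exponential or a geometric law `ν`, then each maximum mean reward is integrable and its
expectation converges to the mean plus the standard deviation of `ν`. -/
theorem mainTheorem6 {Ω : Type*} [MeasurableSpace Ω] (P : Measure Ω) [IsProbabilityMeasure P]
    (r : (Fin 2 → ℕ) → Ω → ℝ) (ν : Measure ℝ)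
    (hν : IsExponentialLaw ν ∨ IsGeometricLaw ν)
    (hlaw : ∀ v : Fin 2 → ℕ, HasLaw (r v) ν P)
    (hindep : iIndepFun r P) :
    (∀ n : ℕ, Integrable (fun ω => maxMeanReward (fun v => r v ω) n) P) ∧
      Tendsto (fun n : ℕ => ∫ ω, maxMeanReward (fun v => r v ω) n ∂P) atTop
        (𝓝 ((∫ x, x ∂ν) + Real.sqrt (variance (fun x : ℝ => x) ν))) := by
  obtain ⟨κ, hκp, hνp, hmem, hsq, hκ, hνi, hmean⟩ := exists_memoryless_of_law hν
  have hν₁ : Integrable (fun x => x) ν := integrable_of_mem_interior_integrableExpSet hνi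
  have hr : AEMeasurable (fun ω v => r v ω) P :=
    aemeasurable_pi_iff.2 fun v => (hlaw v).aemeasurable
  -- Independence makes the law of the whole field the product measure, so integrability and
  -- expectations transfer from the canonical space.
  have hfield := hindep.hasLaw_infinitePi hlaw hr
  have hmm : ∀ n, Integrable (fun f => maxMeanReward f n)
      (Measure.infinitePi fun _ : Fin 2 → ℕ => ν) := fun n =>
    (integrable_maxTotalReward hν₁ n).div_const n
  have hmm' := hmm
  rw [← hfield.map_eq] at hmm'
  refine ⟨fun n => (hmm' n).comp_aemeasurable hr, ?_⟩
  rw [← hmean]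
  refine (tendsto_integral_maxMeanReward (measurePreserving_cornerStep hmem hsq) hκ hν₁).congr
    fun n => ?_
  rw [← hfield.map_eq, integral_map hr (hmm' n).aestronglyMeasurable]
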